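/- For a permutation $\psi$ of a finite set $X$, let $\Lambda(\psi)$ be the largest length of a cycle of $\psi$ (fixed points being cycles of length $1$). For a finite group $G$, let $\Lambda(G):=\max_{\alpha\in\mathrm{Aut}(G)}\Lambda(\alpha)$, where automorphisms are regarded as permutations of $G$, and let $\lambda(G):=\Lambda(G)/|G|$. If $G$ is a finite group with $\lambda(G)>\frac12$ (that is, $G$ has an automorphism with a single cycle containing more than half of the elements of $G$), then $G$ is abelian. The bound $\frac12$ is sharp: for every $n\geq 3$, the dihedral group $\mathrm{D}_{2n}$ of order $2n$ is a nonabelian finite group with $\lambda(\mathrm{D}_{2n})=\frac12$. -/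

import Mathlib

/-- The length of the cycle of the permutation `ψ` that contains `x`: the number of elements lying on
that cycle. A fixed point lies on a cycle of length `1`. -/
noncomputable def cycleLength {X : Type*} (ψ : Equiv.Perm X) (x : X) : ℕ :=
  {y : X | ψ.SameCycle x y}.ncard

/-- `Λ(ψ)`: the largest length of a cycle of the permutation `ψ` of a finite set `X`. For finite `X`
the supremum is over a bounded family, hence it is a maximum when `X` is nonempty. -/
noncomputable def permLambdaAbs {X : Type*} (ψ : Equiv.Perm X) : ℕ :=
  ⨆ x : X, cycleLength ψ x

/-- `Λ(G)`: the maximum of `Λ(α)` over the automorphisms `α` of the finite group `G`. -/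
noncomputable def groupLambdaAbs (G : Type*) [Group G] : ℕ :=
  ⨆ α : MulAut G, permLambdaAbs α.toEquiv

/-- `λ(G) = Λ(G) / |G|` for a finite group `G`. -/
noncomputable def groupLambda (G : Type*) [Group G] : ℚ :=
  (groupLambdaAbs G : ℚ) / (Nat.card G : ℚ)

/-! Let `O` be an orbit of `α` with more than half of `G`. Then `O` meets `O⁻¹`, so a power `ι` of
`α` inverts all of `O`, and `G = O * O⁻¹`. If `H` is invariant and `y ∈ O`, more than half of the
coset `yH` lies in `O`; comparing `ι (y * a)` with `(y * a)⁻¹` gives `y * a * y⁻¹ = (ι a)⁻¹` for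
these `a`. Hence `H` is normal (`HasLargeOrbit.normal`), and central if commutative, because all of
`O` then acts on it alike (`HasLargeOrbit.le_center`).

Large orbits pass to quotients, so by induction every proper invariant quotient is commutative. With
trivial center, comparing the fixed points of a power of `α` with their centralizer settles the
matter. Otherwise `G` has class at most two, and `G ⧸ Z` is an elementary abelian 2-group on which
`ι g * g` induces a quadratic map vanishing on the orbit, with the commutator as polar form.
Invariant isotropic subgroups are trivial there by `le_center`, and
`HasLargeOrbit.subsingleton_of_quadratic` shows that this forces `G = Z`. -/

/-- The orbit of `x` under the cyclic group generated by the automorphism `α`. -/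
def autOrbit {G : Type*} [Group G] (α : MulAut G) (x : G) : Set G :=
  {y | ∃ k : ℤ, (α ^ k) x = y}

/-- The orbit of `x` under `α` contains more than half of the elements of `G`. -/
def HasLargeOrbit {G : Type*} [Group G] (α : MulAut G) (x : G) : Prop :=
  Nat.card G < 2 * (autOrbit α x).ncard

/-- The subgroup `H` is mapped into itself by `α`. -/
def IsAutInvariant {G : Type*} [Group G] (α : MulAut G) (H : Subgroup G) : Prop :=
  ∀ h ∈ H, α h ∈ H

/-! ### Orbits of an automorphism and counting arguments -/

section Orbits

variable {G : Type*} [Group G] {α : MulAut G} {x y : G}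

theorem mem_autOrbit_self (α : MulAut G) (x : G) : x ∈ autOrbit α x := ⟨0, by simp⟩

theorem zpow_add_aut_apply (α : MulAut G) (m n : ℤ) (x : G) :
    (α ^ (m + n)) x = (α ^ m) ((α ^ n) x) := by
  rw [zpow_add, MulAut.mul_apply]

theorem zpow_aut_comm (α : MulAut G) (m n : ℤ) (x : G) :
    (α ^ m) ((α ^ n) x) = (α ^ n) ((α ^ m) x) := by
  rw [← zpow_add_aut_apply, add_comm, zpow_add_aut_apply]

theorem aut_zpow_comm (α : MulAut G) (n : ℤ) (x : G) : α ((α ^ n) x) = (α ^ n) (α x) := by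
  simpa using zpow_aut_comm α 1 n x

theorem zpow_mem_autOrbit (k : ℤ) (hy : y ∈ autOrbit α x) : (α ^ k) y ∈ autOrbit α x := by
  obtain ⟨n, rfl⟩ := hy
  exact ⟨k + n, zpow_add_aut_apply α k n x⟩

theorem autOrbit_eq_of_mem (hy : y ∈ autOrbit α x) : autOrbit α y = autOrbit α x := by
  obtain ⟨n, rfl⟩ := hy
  ext z
  constructor
  · rintro ⟨k, rfl⟩
    exact ⟨k + n, zpow_add_aut_apply α k n x⟩
  · rintro ⟨k, rfl⟩
    exact ⟨k - n, by rw [← zpow_add_aut_apply, sub_add_cancel]⟩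

theorem exists_zpow_apply_eq_of_mem {z : G} (hy : y ∈ autOrbit α x) (hz : z ∈ autOrbit α x) :
    ∃ k : ℤ, (α ^ k) y = z := by
  rw [← autOrbit_eq_of_mem hy] at hz
  exact hz

theorem HasLargeOrbit.of_mem (h : HasLargeOrbit α x) (hy : y ∈ autOrbit α x) :
    HasLargeOrbit α y := by
  rw [HasLargeOrbit, autOrbit_eq_of_mem hy]
  exact h

theorem map_zpow_of_semiconj {G' : Type*} [Group G'] {α' : MulAut G'} {f : G → G'}
    (hf : ∀ g, f (α g) = α' (f g)) (k : ℤ) (g : G) : f ((α ^ k) g) = (α' ^ k) (f g) := by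
  induction k with
  | zero => simp
  | succ n ih =>
    rw [add_comm, zpow_add_aut_apply, zpow_add_aut_apply, zpow_one, hf, ih, zpow_one]
  | pred n ih =>
    apply α'.injective
    have key : ∀ (H : Type _) [Group H] (β : MulAut H) (z : H),
        β ((β ^ (-(n : ℤ) - 1)) z) = (β ^ (-(n : ℤ))) z := fun H _ β z => by
      have := zpow_add_aut_apply β 1 (-(n : ℤ) - 1) z
      rw [zpow_one, add_sub_cancel] at this
      exact this.symm
    rw [← hf, key G', ← ih]
    congr 1
    have := zpow_add_aut_apply α 1 (-(n : ℤ) - 1) g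
    rw [zpow_one, add_sub_cancel] at this
    exact this.symm

theorem zpow_apply_eq_self (h : α x = x) (k : ℤ) : (α ^ k) x = x :=
  (MulAction.stabilizer (MulAut G) x).zpow_mem (x := α) h k

variable [Finite G]

theorem IsAutInvariant.zpow_mem {H : Subgroup G} (hH : IsAutInvariant α H) (k : ℤ) {h : G}
    (hh : h ∈ H) : (α ^ k) h ∈ H := by
  have : Finite (MulAut G) := Finite.of_injective (fun β : MulAut G => (β : G → G))
    DFunLike.coe_injective
  obtain ⟨n, hn⟩ := (mem_powers_iff_mem_zpowers (x := α) (y := α ^ k)).2 ⟨k, rfl⟩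
  rw [← hn]
  clear hn
  induction n with
  | zero => simpa using hh
  | succ n ih =>
    simp only [pow_succ'] at ih ⊢
    exact hH _ ih

theorem inter_nonempty_of_card_lt {X : Type*} [Finite X] {s t : Set X}
    (h : Nat.card X < s.ncard + t.ncard) : (s ∩ t).Nonempty := by
  by_contra hne
  have hd : Disjoint s t := Set.disjoint_iff_inter_eq_empty.2 (Set.not_nonempty_iff_eq_empty.1 hne)
  have := Set.ncard_union_eq hd s.toFinite t.toFinite
  have := Set.ncard_le_card (s ∪ t)
  omega

theorem inter_nonempty_of_subset_subgroup {I : Subgroup G} {s t : Set G} (hs : s ⊆ I) (ht : t ⊆ I)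
    (h : Nat.card I < s.ncard + t.ncard) : (s ∩ t).Nonempty := by
  by_contra hne
  have hd : Disjoint s t := Set.disjoint_iff_inter_eq_empty.2 (Set.not_nonempty_iff_eq_empty.1 hne)
  have h1 := Set.ncard_union_eq hd s.toFinite t.toFinite
  have h2 := Set.ncard_le_ncard (Set.union_subset hs ht) (Set.toFinite _)
  have h3 : (I : Set G).ncard = Nat.card I := rfl
  omega

theorem le_of_card_lt_two_mul {H K : Subgroup G} {s : Set G} (hsH : s ⊆ H) (hsK : s ⊆ K)
    (h : Nat.card H < 2 * s.ncard) : H ≤ K := by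
  have h1 : Nat.card (H ⊓ K : Subgroup G) ∣ Nat.card H :=
    Subgroup.card_dvd_of_le inf_le_left
  have h2 : s.ncard ≤ Nat.card (H ⊓ K : Subgroup G) :=
    Set.ncard_le_ncard (t := ((H ⊓ K : Subgroup G) : Set G)) (fun a ha => ⟨hsH ha, hsK ha⟩)
      (Set.toFinite _)
  obtain ⟨c, hc⟩ := h1
  have hpos : 0 < Nat.card H := Nat.card_pos
  have hc1 : c = 1 := by
    rcases c with _ | _ | c
    · omega
    · rfl
    · nlinarith
  have h3 : H ⊓ K = H := Subgroup.eq_of_le_of_card_ge inf_le_left (by rw [hc, hc1, mul_one])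
  exact inf_eq_left.1 h3

theorem HasLargeOrbit.eq_top (h : HasLargeOrbit α x) {K : Subgroup G} (hK : autOrbit α x ⊆ K) :
    K = ⊤ :=
  top_le_iff.1 <| le_of_card_lt_two_mul (s := autOrbit α x) (by simp) hK (by rwa [Subgroup.card_top])

theorem HasLargeOrbit.exists_mul_inv_eq (h : HasLargeOrbit α x) (g : G) :
    ∃ y ∈ autOrbit α x, ∃ z ∈ autOrbit α x, g = y * z⁻¹ := by
  have h1 : ((g * ·) '' autOrbit α x).ncard = (autOrbit α x).ncard :=
    Set.ncard_image_of_injective _ (mul_right_injective g)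
  obtain ⟨y, hy, z, hz, rfl⟩ := inter_nonempty_of_card_lt
    (s := autOrbit α x) (t := (g * ·) '' autOrbit α x) (by rw [h1]; unfold HasLargeOrbit at h; omega)
  exact ⟨_, hy, z, hz, by simp⟩

theorem HasLargeOrbit.exists_zpow_eq_inv (h : HasLargeOrbit α x) :
    ∃ k : ℤ, ∀ y ∈ autOrbit α x, (α ^ k) y = y⁻¹ := by
  have h1 : ((autOrbit α x)⁻¹).ncard = (autOrbit α x).ncard := by
    rw [← Set.image_inv_eq_inv]
    exact Set.ncard_image_of_injective _ inv_injective
  obtain ⟨y, hy, hy'⟩ := inter_nonempty_of_card_lt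
    (s := autOrbit α x) (t := (autOrbit α x)⁻¹) (by rw [h1]; unfold HasLargeOrbit at h; omega)
  obtain ⟨k, hk⟩ := exists_zpow_apply_eq_of_mem hy (Set.mem_inv.1 hy')
  refine ⟨k, fun z hz => ?_⟩
  obtain ⟨n, rfl⟩ := exists_zpow_apply_eq_of_mem hy hz
  rw [zpow_aut_comm, hk, map_inv]

/-- Every coset `xH` of an invariant subgroup `H` that meets the orbit does so in more than half of
its elements. -/
theorem HasLargeOrbit.card_lt_two_mul_fiber (h : HasLargeOrbit α x) {H : Subgroup G}
    (hH : IsAutInvariant α H) :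
    Nat.card H < 2 * {a : G | a ∈ H ∧ x * a ∈ autOrbit α x}.ncard := by
  classical
  have : Fintype G := Fintype.ofFinite G
  have : Fintype (G ⧸ H) := Fintype.ofFinite _
  have hG : Nat.card G = Nat.card (G ⧸ H) * Nat.card H := Subgroup.card_eq_card_quotient_mul_card_subgroup H
  have hO : (autOrbit α x).ncard = (autOrbit α x).toFinset.card := Set.ncard_eq_toFinset_card' _
  obtain ⟨c, -, hc⟩ := Finset.exists_lt_card_fiber_of_mul_lt_card_of_maps_to
    (s := (autOrbit α x).toFinset) (t := (Finset.univ : Finset (G ⧸ H)))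
    (f := fun g => (g : G ⧸ H)) (n := Nat.card H / 2) (fun _ _ => Finset.mem_univ _) (by
      rw [Finset.card_univ, ← Nat.card_eq_fintype_card, ← hO]
      have h1 : 2 * (Nat.card H / 2) ≤ Nat.card H := Nat.mul_div_le _ _
      unfold HasLargeOrbit at h
      nlinarith)
  obtain ⟨y, hy⟩ : (Finset.filter (fun g : G => (g : G ⧸ H) = c) (autOrbit α x).toFinset).Nonempty :=
    Finset.card_pos.1 (by omega)
  rw [Finset.mem_filter, Set.mem_toFinset] at hy
  obtain ⟨hyO, rfl⟩ := hy
  obtain ⟨k, hk⟩ := exists_zpow_apply_eq_of_mem hyO (mem_autOrbit_self α x)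
  have hle : (Finset.filter (fun g : G => (g : G ⧸ H) = y) (autOrbit α x).toFinset).card ≤
      {a : G | a ∈ H ∧ x * a ∈ autOrbit α x}.ncard := by
    rw [← Set.ncard_coe_finset]
    refine Set.ncard_le_ncard_of_injOn (fun g => x⁻¹ * (α ^ k) g) ?_ ?_ (Set.toFinite _)
    · intro g hg
      simp only [Finset.coe_filter, Set.mem_toFinset, Set.mem_ofPred_eq] at hg
      refine ⟨?_, ?_⟩
      · have h2 : y⁻¹ * g ∈ H := QuotientGroup.eq.1 hg.2.symm
        have h3 := hH.zpow_mem k h2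
        rwa [map_mul, map_inv, hk] at h3
      · simpa using zpow_mem_autOrbit k hg.1
    · intro a _ b _ hab
      exact (α ^ k).injective (mul_left_cancel hab)
  omega

/-- Each fibre of `f` has at most `|ker f|` elements, so the density of an orbit cannot drop when
passing to the image. -/
theorem card_range_lt_two_mul_orbit {G' : Type*} [Group G'] [Finite G'] (h : HasLargeOrbit α x)
    {α' : MulAut G'} {f : G →* G'} (hf : ∀ g, f (α g) = α' (f g)) :
    Nat.card f.range < 2 * (autOrbit α' (f x)).ncard := by
  classical
  have : Fintype G := Fintype.ofFinite G
  have hG : Nat.card G = Nat.card f.ker * Nat.card f.range := by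
    rw [← Subgroup.index_ker, Subgroup.card_mul_index]
  have h1 : (autOrbit α x).toFinset.card ≤
      Nat.card f.ker * ((autOrbit α x).toFinset.image f).card := by
    refine Finset.card_le_mul_card_image _ _ fun c hc => ?_
    obtain ⟨a, ha, rfl⟩ := Finset.mem_image.1 hc
    rw [← Set.ncard_coe_finset]
    refine Set.ncard_le_ncard_of_injOn (t := (f.ker : Set G)) (fun g => a⁻¹ * g) ?_ ?_
      (Set.toFinite _)
    · intro g hg
      simp only [Finset.coe_filter, Set.mem_ofPred_eq] at hg
      simp [MonoidHom.mem_ker, hg.2]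
    · intro b _ c _ hbc
      exact mul_left_cancel hbc
  have h2 : ((autOrbit α x).toFinset.image f).card ≤ (autOrbit α' (f x)).ncard := by
    rw [← Set.ncard_coe_finset]
    refine Set.ncard_le_ncard ?_ (Set.toFinite _)
    intro z hz
    simp only [Finset.coe_image, Set.coe_toFinset] at hz
    obtain ⟨_, ⟨k, rfl⟩, rfl⟩ := hz
    exact ⟨k, (map_zpow_of_semiconj hf k x).symm⟩
  have hO : (autOrbit α x).ncard = (autOrbit α x).toFinset.card := Set.ncard_eq_toFinset_card' _
  unfold HasLargeOrbit at h
  have h3 := Nat.mul_le_mul_left (Nat.card f.ker) h2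
  have hpos : 0 < Nat.card f.ker := Nat.card_pos
  refine lt_of_mul_lt_mul_left (a := Nat.card f.ker) ?_ (Nat.zero_le _)
  calc Nat.card f.ker * Nat.card f.range = Nat.card G := hG.symm
    _ < 2 * (autOrbit α x).ncard := h
    _ ≤ 2 * (Nat.card f.ker * (autOrbit α' (f x)).ncard) := by omega
    _ = _ := by ring

end Orbits

/-! ### Minimal invariant subgroups of commutative groups -/

/-- `I` is minimal among the nontrivial `α`-invariant subgroups. -/
structure IsMinimalInvariant {V : Type*} [Group V] (α : MulAut V) (I : Subgroup V) : Prop where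
  ne_bot : I ≠ ⊥
  invariant : IsAutInvariant α I
  eq_of_le : ∀ K : Subgroup V, IsAutInvariant α K → K ≤ I → K ≠ ⊥ → K = I

theorem exists_isMinimalInvariant_le {V : Type*} [Group V] [Finite V] {α : MulAut V}
    {J : Subgroup V} (hJ : IsAutInvariant α J) (hne : J ≠ ⊥) :
    ∃ I ≤ J, IsMinimalInvariant α I := by
  obtain ⟨I, hIJ, hI⟩ := exists_minimal_le_of_wellFoundedLT
    (fun K : Subgroup V => IsAutInvariant α K ∧ K ≠ ⊥) J ⟨hJ, hne⟩
  exact ⟨I, hIJ, hI.prop.2, hI.prop.1, fun K hK hKI hK1 => le_antisymm hKI (hI.2 ⟨hK, hK1⟩ hKI)⟩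

theorem isAutInvariant_range {V : Type*} [Group V] {α : MulAut V} {π : V →* V}
    (hπ : ∀ w, π (α w) = α (π w)) : IsAutInvariant α π.range := by
  rintro _ ⟨v, rfl⟩
  exact ⟨α v, hπ v⟩

theorem exists_ne_one_of_ne_bot {V : Type*} [Group V] {I : Subgroup V} (hI : I ≠ ⊥) : ∃ i ∈ I, i ≠ 1 := by
  obtain ⟨⟨i, hi⟩, hi1⟩ := (Subgroup.ne_bot_iff_exists_ne_one).1 hI
  exact ⟨i, hi, fun hc => hi1 (Subtype.ext hc)⟩

section Commutative

variable {V : Type*} [CommGroup V] [Finite V] {α : MulAut V} {x : V}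

/-- The values at `x` of endomorphisms commuting with `α` form a subgroup, and the powers of `α` put
the whole orbit into it. -/
theorem HasLargeOrbit.exists_hom_apply_eq (h : HasLargeOrbit α x) (v : V) :
    ∃ π : V →* V, (∀ w, π (α w) = α (π w)) ∧ π x = v := by
  let K : Subgroup V :=
    { carrier := {v | ∃ π : V →* V, (∀ w, π (α w) = α (π w)) ∧ π x = v}
      one_mem' := ⟨1, by simp, by simp⟩
      mul_mem' := by
        rintro _ _ ⟨π, hπ, rfl⟩ ⟨σ, hσ, rfl⟩
        exact ⟨π * σ, fun w => by simp [hπ, hσ], rfl⟩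
      inv_mem' := by
        rintro _ ⟨π, hπ, rfl⟩
        exact ⟨π⁻¹, fun w => by simp [hπ], rfl⟩ }
  have hK : K = ⊤ := by
    refine h.eq_top ?_
    rintro _ ⟨k, rfl⟩
    exact ⟨(α ^ k).toMonoidHom, fun w => (aut_zpow_comm α k w).symm, rfl⟩
  have hv : v ∈ K := hK ▸ Subgroup.mem_top v
  exact hv

/-- Some `π` commuting with `α` sends `x` to `i`. By minimality its range is `I`, and the image of a
large orbit is large. -/
theorem IsMinimalInvariant.card_lt_two_mul_orbit (h : HasLargeOrbit α x) {I : Subgroup V}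
    (hI : IsMinimalInvariant α I) {i : V} (hi : i ∈ I) (hi1 : i ≠ 1) :
    Nat.card I < 2 * (autOrbit α i).ncard := by
  obtain ⟨π, hπ, rfl⟩ := h.exists_hom_apply_eq i
  have hle : π.range ≤ I := by
    have htop : I.comap π = ⊤ := by
      refine h.eq_top ?_
      rintro _ ⟨k, rfl⟩
      change π ((α ^ k) x) ∈ I
      rw [map_zpow_of_semiconj hπ]
      exact hI.invariant.zpow_mem k hi
    rintro _ ⟨v, rfl⟩
    have hv : v ∈ I.comap π := htop ▸ Subgroup.mem_top v
    exact hv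
  have hr : π.range = I := hI.eq_of_le _ (isAutInvariant_range hπ) hle fun hb =>
    hi1 (Subgroup.mem_bot.1 (hb ▸ (⟨x, rfl⟩ : π x ∈ π.range)))
  rw [← hr]
  exact card_range_lt_two_mul_orbit h hπ

theorem IsMinimalInvariant.orbit_subset {I : Subgroup V} (hI : IsMinimalInvariant α I) {i : V}
    (hi : i ∈ I) : autOrbit α i ⊆ I := by
  rintro _ ⟨k, rfl⟩
  exact hI.invariant.zpow_mem k hi

theorem IsMinimalInvariant.exists_zpow_eq (h : HasLargeOrbit α x) {I : Subgroup V}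
    (hI : IsMinimalInvariant α I) {i j : V} (hi : i ∈ I) (hi1 : i ≠ 1) (hj : j ∈ I) (hj1 : j ≠ 1) :
    ∃ k : ℤ, (α ^ k) i = j := by
  have h1 := hI.card_lt_two_mul_orbit h hi hi1
  have h2 := hI.card_lt_two_mul_orbit h hj hj1
  obtain ⟨z, hz, hz'⟩ := inter_nonempty_of_subset_subgroup (hI.orbit_subset hi)
    (hI.orbit_subset hj) (by omega)
  have h3 : autOrbit α i = autOrbit α j := by
    rw [← autOrbit_eq_of_mem hz, autOrbit_eq_of_mem hz']
  have h4 : j ∈ autOrbit α i := h3 ▸ mem_autOrbit_self α j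
  exact h4

theorem IsMinimalInvariant.four_le_card (h : HasLargeOrbit α x) {I : Subgroup V}
    (hI : IsMinimalInvariant α I) (hexp : ∀ v : V, v * v = 1) : 4 ≤ Nat.card I := by
  classical
  obtain ⟨i, hi, hi1⟩ := exists_ne_one_of_ne_bot hI.ne_bot
  have h1 := hI.card_lt_two_mul_orbit h hi hi1
  have hns : ∃ j ∈ autOrbit α i, j ≠ i := by
    by_contra! hcon
    have h2 : (autOrbit α i).ncard ≤ 1 :=
      (Set.ncard_le_one (Set.toFinite _)).2 fun a ha b hb => (hcon a ha).trans (hcon b hb).symm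
    have h3 : ({1, i} : Set V).ncard = 2 := Set.ncard_pair hi1.symm
    have h4 : ({1, i} : Set V).ncard ≤ Nat.card I :=
      Set.ncard_le_ncard (t := (I : Set V))
        (by rintro a (rfl | rfl); exacts [I.one_mem, hi]) (Set.toFinite _)
    omega
  obtain ⟨_, ⟨k, rfl⟩, hj⟩ := hns
  set j := (α ^ k) i with hjdef
  have hjI : j ∈ I := hI.invariant.zpow_mem k hi
  have hj1 : j ≠ 1 := by simpa [hjdef] using hi1
  have hsub : (({1, i, j, i * j} : Finset V) : Set V) ⊆ I := by
    intro a ha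
    simp only [Finset.coe_insert, Finset.coe_singleton, Set.mem_insert_iff,
      Set.mem_singleton_iff] at ha
    rcases ha with rfl | rfl | rfl | rfl
    exacts [I.one_mem, hi, hjI, I.mul_mem hi hjI]
  have hcard : ({1, i, j, i * j} : Finset V).card = 4 := by
    have hij : i * j ≠ 1 := fun hc => hj (mul_left_cancel (hc.trans (hexp i).symm))
    rw [Finset.card_insert_of_notMem, Finset.card_insert_of_notMem, Finset.card_insert_of_notMem,
      Finset.card_singleton]
    · simpa using hi1
    · simp [hj.symm, hj1]
    · simp [hi1.symm, hj1.symm, hij.symm]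
  have h5 := Set.ncard_le_ncard hsub (Set.toFinite _)
  rw [Set.ncard_coe_finset, hcard] at h5
  exact h5

/-- A coset `xI` of a minimal invariant subgroup contains a point `p`, fixed by a power `τ` of `α`,
such that all of `xI` except `p` lies on the orbit of `x`. -/
theorem IsMinimalInvariant.exists_fixed_point (h : HasLargeOrbit α x) {I : Subgroup V}
    (hI : IsMinimalInvariant α I) (hexp : ∀ v : V, v * v = 1) :
    ∃ m : ℤ, (∀ i ∈ I, (α ^ m) i = i → i = 1) ∧ (∀ v, v⁻¹ * (α ^ m) v ∈ I) ∧
      ∃ p : V, ∀ i ∈ I, i ≠ 1 → p * i ∈ autOrbit α x := by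
  -- The exponents whose power of `α` stabilizes the coset `xI`; a generator `m` accounts for all of
  -- the orbit inside `xI`.
  let T : AddSubgroup ℤ :=
    { carrier := {k | x⁻¹ * (α ^ k) x ∈ I}
      zero_mem' := by simp
      add_mem' := by
        intro a b ha hb
        have h1 := I.mul_mem ha (hI.invariant.zpow_mem a hb)
        simpa [zpow_add_aut_apply, mul_assoc] using h1
      neg_mem' := by
        intro a ha
        have h1 := I.inv_mem (hI.invariant.zpow_mem (-a) ha)
        rw [map_mul, map_inv, ← zpow_add_aut_apply, neg_add_cancel, zpow_zero,
          MulAut.one_apply, mul_inv_rev, inv_inv] at h1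
        exact h1 }
  obtain ⟨m, hm⟩ : ∃ m : ℤ, T = AddSubgroup.zmultiples m := by
    obtain ⟨m, hm⟩ := Int.subgroup_cyclic T
    exact ⟨m, by rw [hm, AddSubgroup.zmultiples_eq_closure]⟩
  have hmT : x⁻¹ * (α ^ m) x ∈ I := by
    have : m ∈ T := hm ▸ AddSubgroup.mem_zmultiples m
    exact this
  have hfib := h.card_lt_two_mul_fiber hI.invariant
  have hpow : ∀ a, a ∈ I → x * a ∈ autOrbit α x → ∃ l : ℤ, ((α ^ m) ^ l) x = x * a := by
    rintro a ha ⟨k, hk⟩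
    have hkT : k ∈ T := by
      change x⁻¹ * (α ^ k) x ∈ I
      rw [hk]; simpa using ha
    rw [hm] at hkT
    obtain ⟨l, rfl⟩ := AddSubgroup.mem_zmultiples_iff.1 hkT
    exact ⟨l, by rw [← zpow_mul, mul_comm, ← hk]; simp⟩
  have h4 := hI.four_le_card h hexp
  obtain ⟨c, hc⟩ : ∃ c, c = x⁻¹ * (α ^ m) x := ⟨_, rfl⟩
  have hcx : (α ^ m) x = x * c := by rw [hc, mul_inv_cancel_left]
  rw [← hc] at hmT
  -- If `α ^ m` fixed some `i ≠ 1` in `I`, transitivity of `α` would make it trivial on `I`. Then at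
  -- most two points of `xI` would lie on the orbit, too few since `|I| ≥ 4`.
  have hfree : ∀ i ∈ I, (α ^ m) i = i → i = 1 := by
    by_contra! hcon
    obtain ⟨i, hi, hfix, hi1⟩ := hcon
    have htriv : ∀ j ∈ I, (α ^ m) j = j := by
      intro j hj
      by_cases hj1 : j = 1
      · simp [hj1]
      · obtain ⟨k, rfl⟩ := hI.exists_zpow_eq h hi hi1 hj hj1
        rw [zpow_aut_comm, hfix]
    have hx2 : ∀ l : ℤ, ((α ^ m) ^ l) x = x ∨ ((α ^ m) ^ l) x = x * c := by
      have hsq : ((α ^ m) ^ (2 : ℤ)) x = x := by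
        rw [zpow_two, MulAut.mul_apply, hcx, map_mul, hcx, htriv c hmT, mul_assoc, hexp, mul_one]
      intro l
      obtain ⟨n, rfl | rfl⟩ := Int.even_or_odd' l
      · left
        rw [zpow_mul]
        exact zpow_apply_eq_self hsq n
      · right
        rw [add_comm, zpow_add_aut_apply, zpow_mul, zpow_apply_eq_self hsq n, zpow_one, hcx]
    have hsub : {a : V | a ∈ I ∧ x * a ∈ autOrbit α x} ⊆ {1, c} := by
      rintro a ⟨ha, ha'⟩
      obtain ⟨l, hl⟩ := hpow a ha ha'
      rcases hx2 l with h1 | h1 <;> rw [hl] at h1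
      · left; simpa using h1
      · right; exact mul_left_cancel h1
    have h5 := (Set.ncard_le_ncard hsub (Set.toFinite _)).trans (Set.ncard_insert_le 1 {c})
    rw [Set.ncard_singleton] at h5
    omega
  have hcomm : ∀ v, v⁻¹ * (α ^ m) v ∈ I := by
    let D : V →* V := (α ^ m).toMonoidHom * (MonoidHom.id V)⁻¹
    have hD : ∀ v, D v = (α ^ m) v * v⁻¹ := fun v => rfl
    have htop : I.comap D = ⊤ := by
      refine h.eq_top ?_
      rintro _ ⟨k, rfl⟩
      change D ((α ^ k) x) ∈ I
      rw [hD, zpow_aut_comm, ← map_inv, ← map_mul, hcx]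
      refine hI.invariant.zpow_mem k ?_
      simpa using hmT
    intro v
    have hv : v ∈ I.comap D := htop ▸ Subgroup.mem_top v
    rw [mul_comm]
    exact hv
  refine ⟨m, hfree, hcomm, ?_⟩
  -- Having no nontrivial fixed point, `i ↦ i⁻¹ * (α ^ m) i` is injective on the finite group `I`,
  -- hence onto; this makes `x * d⁻¹` a fixed point of `α ^ m`.
  have hsurj : ∃ d ∈ I, (α ^ m) d = d * c := by
    let E : I → I := fun i => ⟨(i : V)⁻¹ * (α ^ m) i, hcomm i⟩
    have hE : Function.Injective E := by
      intro a b hab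
      have h1 : (a : V)⁻¹ * (α ^ m) a = (b : V)⁻¹ * (α ^ m) b := congrArg Subtype.val hab
      have h2 : (α ^ m) ((a : V) * (b : V)⁻¹) = (a : V) * (b : V)⁻¹ := by
        rw [map_mul, map_inv, ← mul_right_inj ((a : V)⁻¹), ← mul_assoc, h1]
        simp [mul_left_comm]
      have h3 := hfree _ (I.mul_mem a.2 (I.inv_mem b.2)) h2
      exact Subtype.ext (mul_inv_eq_one.1 h3)
    obtain ⟨d, hd⟩ := (Finite.surjective_of_injective hE) ⟨c, hmT⟩
    have hd' : (d : V)⁻¹ * (α ^ m) d = c := congrArg Subtype.val hd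
    exact ⟨d, d.2, by rw [← hd', mul_inv_cancel_left]⟩
  obtain ⟨d, hd, hdc⟩ := hsurj
  have hp : (α ^ m) (x * d⁻¹) = x * d⁻¹ := by
    rw [map_mul, map_inv, hdc, hcx, mul_inv_rev, mul_assoc, mul_inv_cancel_left]
  have hpl : ∀ l : ℤ, ((α ^ m) ^ l) (x * d⁻¹) = x * d⁻¹ :=
    zpow_apply_eq_self hp
  have hxl : ∀ l : ℤ, ((α ^ m) ^ l) x = x * d⁻¹ * ((α ^ m) ^ l) d := by
    intro l
    conv_lhs => rw [← inv_mul_cancel_right x d, map_mul, hpl]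
  have hsub : {a : V | a ∈ I ∧ x * a ∈ autOrbit α x} ⊆ (d⁻¹ * ·) '' autOrbit (α ^ m) d := by
    rintro a ⟨ha, ha'⟩
    obtain ⟨l, hl⟩ := hpow a ha ha'
    refine ⟨_, ⟨l, rfl⟩, ?_⟩
    rw [hxl, mul_assoc] at hl
    exact mul_left_cancel hl
  have h6 : Nat.card I < 2 * (autOrbit (α ^ m) d).ncard := by
    have := (Set.ncard_le_ncard hsub (Set.toFinite _)).trans (Set.ncard_image_le (Set.toFinite _))
    omega
  have hd1 : d ≠ 1 := by
    rintro rfl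
    have h7 : (autOrbit (α ^ m) (1 : V)).ncard ≤ 1 := by
      refine (Set.ncard_le_one (Set.toFinite _)).2 ?_
      rintro _ ⟨k, rfl⟩ _ ⟨k', rfl⟩
      simp
    omega
  refine ⟨x * d⁻¹, fun i hi hi1 => ?_⟩
  obtain ⟨k, rfl⟩ := hI.exists_zpow_eq h hd hd1 hi hi1
  have hsubI : ∀ e ∈ I, autOrbit (α ^ m) e ⊆ I := by
    rintro e he _ ⟨l, rfl⟩
    rw [SetLike.mem_coe, ← zpow_mul]
    exact hI.invariant.zpow_mem _ he
  have himg : autOrbit (α ^ m) ((α ^ k) d) = (α ^ k) '' autOrbit (α ^ m) d := by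
    ext z
    constructor
    · rintro ⟨l, rfl⟩
      exact ⟨_, ⟨l, rfl⟩, by rw [← zpow_mul, zpow_aut_comm]⟩
    · rintro ⟨_, ⟨l, rfl⟩, rfl⟩
      exact ⟨l, by rw [← zpow_mul, zpow_aut_comm]⟩
  -- Powers of `α` permute the `α ^ m`-orbits, so all those in `I` other than `{1}` have the same
  -- size, more than half of `I`. Hence there is only one.
  have hcard : (autOrbit (α ^ m) ((α ^ k) d)).ncard = (autOrbit (α ^ m) d).ncard := by
    rw [himg]
    exact Set.ncard_image_of_injective _ (α ^ k).injective
  obtain ⟨z, hz, hz'⟩ := inter_nonempty_of_subset_subgroup (hsubI _ hd) (hsubI _ hi) (by omega)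
  have hmem : (α ^ k) d ∈ autOrbit (α ^ m) d := by
    rw [← autOrbit_eq_of_mem hz, autOrbit_eq_of_mem hz']
    exact mem_autOrbit_self _ _
  obtain ⟨l, hl⟩ := hmem
  rw [← hl, ← hxl, ← zpow_mul]
  exact ⟨_, rfl⟩

end Commutative

/-! ### Quadratic maps vanishing on a large orbit -/

/-- On a minimal invariant `I`, the vanishing of `q` on `p * i` for `i ≠ 1` makes `b` constant on
distinct nontrivial pairs, which forces `1 + α + α²` (additively) to kill `I`. The fixed-point-free
power of `α` then excludes a nonzero range of this operator. Only the zero set of `q` has to be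
invariant, so no action on `W` is needed. -/
theorem HasLargeOrbit.subsingleton_of_quadratic {V W : Type*} [CommGroup V] [Finite V]
    [CommGroup W] {α : MulAut V} {x : V} (h : HasLargeOrbit α x) (hexp : ∀ v : V, v * v = 1)
    {q : V → W} {b : V → V → W} (hq : ∀ u v, q (u * v) = q u * q v * b u v)
    (hb : ∀ u v w, b u (v * w) = b u v * b u w) (hqα : ∀ v, q (α v) = 1 ↔ q v = 1)
    (hqx : q x = 1)
    (hiso : ∀ I : Subgroup V, IsAutInvariant α I → (∀ i ∈ I, ∀ j ∈ I, b i j = 1) → I = ⊥) :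
    Subsingleton V := by
  have hqk : ∀ (k : ℤ) (v : V), q ((α ^ k) v) = 1 ↔ q v = 1 := by
    intro k v
    induction k with
    | zero => simp
    | succ n ih => rw [add_comm, zpow_add_aut_apply, zpow_one, hqα, ih]
    | pred n ih =>
      rw [← hqα, ← ih]
      have := zpow_add_aut_apply α 1 (-(n : ℤ) - 1) v
      rw [zpow_one, add_sub_cancel] at this
      rw [this]
  have hqO : ∀ y ∈ autOrbit α x, q y = 1 := by
    rintro _ ⟨k, rfl⟩
    exact (hqk k x).2 hqx
  have hb1 : ∀ u, b u 1 = 1 := fun u => by simpa using hb u 1 1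
  have hq1 : q 1 = 1 := by simpa [hb1] using hq 1 1
  have hb1' : ∀ u, b 1 u = 1 := fun u => by simpa [hq1] using hq 1 u
  have htriple : ∀ I : Subgroup V, IsMinimalInvariant α I → ∀ i ∈ I, i * α i * α (α i) = 1 := by
    intro I hI i hi
    by_cases hi1 : i = 1
    · simp [hi1]
    obtain ⟨m, -, -, p, hp⟩ := hI.exists_fixed_point h hexp
    have hf : ∀ e ∈ I, e ≠ 1 → q e * b p e = (q p)⁻¹ := by
      intro e he he1
      have h1 := hq p e
      rw [hqO _ (hp e he he1), mul_assoc] at h1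
      exact eq_inv_of_mul_eq_one_right h1.symm
    have hconst : ∀ e ∈ I, ∀ f ∈ I, e ≠ 1 → f ≠ 1 → e ≠ f → b e f = q p := by
      intro e he f hf' he1 hf1 hef
      have hef1 : e * f ≠ 1 := fun hc => hef (mul_left_cancel ((hexp e).trans hc.symm))
      have h1 := hf _ (I.mul_mem he hf') hef1
      have h2 : q (e * f) * b p (e * f) = (q e * b p e) * (q f * b p f) * b e f := by
        rw [hq, hb]
        simp only [mul_left_comm, mul_comm]
      rw [h1, hf e he he1, hf f hf' hf1] at h2
      rw [mul_assoc] at h2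
      exact (inv_mul_eq_one.1 (mul_left_cancel (h2.symm.trans (mul_one _).symm))).symm
    have h4 := hI.four_le_card h hexp
    have horb := hI.card_lt_two_mul_orbit h hi hi1
    have hai : α i ≠ i := by
      intro hfix
      have : autOrbit α i ⊆ {i} := by
        rintro _ ⟨k, rfl⟩
        exact zpow_apply_eq_self hfix k
      have := Set.ncard_le_ncard this (Set.toFinite _)
      rw [Set.ncard_singleton] at this
      omega
    have haai : α (α i) ≠ i := by
      intro hfix
      have hsq : (α ^ (2 : ℤ)) i = i := by rw [zpow_two, MulAut.mul_apply, hfix]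
      have : autOrbit α i ⊆ {i, α i} := by
        rintro _ ⟨k, rfl⟩
        obtain ⟨n, rfl | rfl⟩ := Int.even_or_odd' k
        · left
          rw [zpow_mul]
          exact zpow_apply_eq_self hsq n
        · right
          rw [add_comm, zpow_add_aut_apply, zpow_mul, zpow_apply_eq_self hsq n, zpow_one]
          rfl
      have h5 := (Set.ncard_le_ncard this (Set.toFinite _)).trans (Set.ncard_insert_le i {α i})
      rw [Set.ncard_singleton] at h5
      omega
    by_contra hne
    have hj := hI.invariant i hi
    have hk := hI.invariant _ hj
    have hj1 : α i ≠ 1 := by simpa using hi1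
    have hk1 : α (α i) ≠ 1 := by simpa using hi1
    have hjk : α i ≠ α (α i) := fun hc => hai (α.injective hc).symm
    have hjk1 : α i * α (α i) ≠ 1 := fun hc => hjk (mul_left_cancel ((hexp (α i)).trans hc.symm))
    have hijk : i ≠ α i * α (α i) := fun hc => hne (by
      rw [mul_assoc, ← hc, hexp])
    -- Bilinearity turns the constant value `q p` of `b` into `q p = q p * q p`.
    have hw : q p = 1 := by
      have h5 := hb i (α i) (α (α i))
      rw [hconst i hi _ (I.mul_mem hj hk) hi1 hjk1 hijk, hconst i hi _ hj hi1 hj1 hai.symm,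
        hconst i hi _ hk hi1 hk1 haai.symm] at h5
      simpa using h5
    refine hI.ne_bot (hiso I hI.invariant fun e he f hf' => ?_)
    by_cases he1 : e = 1
    · rw [he1, hb1']
    by_cases hf1 : f = 1
    · rw [hf1, hb1]
    by_cases hef : e = f
    · subst hef
      obtain ⟨g, hg, hg1, hge⟩ : ∃ g ∈ I, g ≠ 1 ∧ g ≠ e := by
        by_cases hie : i = e
        · exact ⟨α i, hj, hj1, hie ▸ hai⟩
        · exact ⟨i, hi, hi1, hie⟩
      have heg1 : e * g ≠ 1 := fun hc => hge (mul_left_cancel (hc.trans (hexp e).symm))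
      have heg : e ≠ e * g := fun hc => hg1 (by simpa using hc)
      have h5 := hb e g (e * g)
      rw [hconst e he g hg he1 hg1 hge.symm, hconst e he _ (I.mul_mem he hg) he1 heg1 heg, hw,
        mul_left_comm, hexp, mul_one, mul_one] at h5
      exact h5
    · rw [hconst e he f hf' he1 hf1 hef, hw]
  by_contra hsub
  rw [not_subsingleton_iff_nontrivial] at hsub
  obtain ⟨I, -, hI⟩ := exists_isMinimalInvariant_le (α := α) (J := (⊤ : Subgroup V))
    (fun _ _ => Subgroup.mem_top _) top_ne_bot
  let π : V →* V := MonoidHom.id V * α.toMonoidHom * (α.toMonoidHom.comp α.toMonoidHom)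
  have hπ : ∀ v, π v = v * α v * α (α v) := fun v => rfl
  have hπα : ∀ v, π (α v) = α (π v) := fun v => by simp [hπ]
  -- If `1 + α + α² = 0`, then `α ^ 3` fixes `x`, so `|V| < 6`; as `|I| ≥ 4`, `I` is all of `V` and
  -- `q` vanishes identically.
  by_cases hr : π.range = ⊥
  · have hker : ∀ v, v * α v * α (α v) = 1 := fun v =>
      Subgroup.mem_bot.1 (hr ▸ (⟨v, rfl⟩ : π v ∈ π.range))
    have hcube : (α ^ (3 : ℤ)) x = x := by
      have h1 := hker x
      have h2 := hker (α x)
      have h3 : α (α (α x)) = x := by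
        rw [mul_assoc, mul_comm] at h1
        exact mul_left_cancel (h2.trans h1.symm)
      simpa [zpow_ofNat, pow_succ, MulAut.mul_apply] using h3
    have hsub3 : autOrbit α x ⊆ {x, α x, α (α x)} := by
      rintro _ ⟨k, rfl⟩
      have h1 : (α ^ k) x = (α ^ (k % 3)) x := by
        conv_lhs => rw [← Int.emod_add_mul_ediv k 3, zpow_add_aut_apply, zpow_mul,
          zpow_apply_eq_self hcube]
      rw [h1]
      have h2 : k % 3 = 0 ∨ k % 3 = 1 ∨ k % 3 = 2 := by omega
      rcases h2 with h2 | h2 | h2 <;> rw [h2]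
      · left; simp
      · right; left; simp
      · right; right
        rw [zpow_two]; rfl
    have h3 : (autOrbit α x).ncard ≤ 3 := by
      refine (Set.ncard_le_ncard hsub3 (Set.toFinite _)).trans ?_
      have h5 := Set.ncard_insert_le x {α x, α (α x)}
      have h6 := Set.ncard_insert_le (α x) {α (α x)}
      rw [Set.ncard_singleton] at h6
      omega
    have h4 := hI.four_le_card h hexp
    obtain ⟨c, hc⟩ := Subgroup.card_subgroup_dvd_card I
    have hV : Nat.card V < 2 * (autOrbit α x).ncard := h
    have hc1 : c ≤ 1 := by
      by_contra hc1
      have : Nat.card I * 2 ≤ Nat.card I * c := Nat.mul_le_mul_left _ (by omega)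
      omega
    have hItop : I = ⊤ := Subgroup.eq_top_of_le_card I (by
      rw [hc]; exact (Nat.mul_le_mul_left _ hc1).trans (by simp))
    have hx1 : x ≠ 1 := by
      rintro rfl
      have h5 : autOrbit α (1 : V) ⊆ {1} := by
        rintro _ ⟨k, rfl⟩
        simp
      have h6 := Set.ncard_le_ncard h5 (Set.toFinite _)
      have h7 : 1 < Nat.card V := Finite.one_lt_card
      rw [Set.ncard_singleton] at h6
      omega
    have hqall : ∀ v, q v = 1 := by
      intro v
      by_cases hv1 : v = 1
      · rw [hv1, hq1]
      · obtain ⟨k, rfl⟩ := hI.exists_zpow_eq h (hItop ▸ Subgroup.mem_top x) hx1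
          (hItop ▸ Subgroup.mem_top v) hv1
        exact (hqk k x).2 hqx
    exact hI.ne_bot (hiso I hI.invariant fun i _ j _ => by simpa [hqall] using (hq i j).symm)
  · obtain ⟨J, hJr, hJ⟩ := exists_isMinimalInvariant_le (isAutInvariant_range hπα) hr
    obtain ⟨m, hfree, hcomm, -⟩ := hJ.exists_fixed_point h hexp
    obtain ⟨i, hi, hi1⟩ := exists_ne_one_of_ne_bot hJ.ne_bot
    obtain ⟨v, rfl⟩ := hJr hi
    refine hi1 (hfree _ hi ?_)
    -- `π` kills `J`, which contains `v⁻¹ * (α ^ m) v`; so `π v` is a fixed point of `α ^ m` in `J`.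
    have h1 : π (v⁻¹ * (α ^ m) v) = 1 := htriple J hJ _ (hcomm v)
    rw [map_mul, map_inv, map_zpow_of_semiconj hπα] at h1
    exact (inv_mul_eq_one.1 h1).symm

/-! ### Invariant subgroups, class two and the induction -/

theorem isAutInvariant_center {G : Type*} [Group G] (α : MulAut G) : IsAutInvariant α (Subgroup.center G) := by
  intro z hz
  rw [Subgroup.mem_center_iff] at hz ⊢
  intro g
  obtain ⟨g, rfl⟩ := α.surjective g
  rw [← map_mul, hz, map_mul]

section Noncommutative

variable {G : Type*} [Group G] [Finite G] {α : MulAut G} {x : G}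

theorem HasLargeOrbit.conj_mem (h : HasLargeOrbit α x) {H : Subgroup G}
    (hH : IsAutInvariant α H) {y : G} (hy : y ∈ autOrbit α x) {a : G} (ha : a ∈ H) :
    y * a * y⁻¹ ∈ H := by
  obtain ⟨k, hk⟩ := h.exists_zpow_eq_inv
  have hle : H ≤ H.comap (MulAut.conj y).toMonoidHom := by
    refine le_of_card_lt_two_mul (s := {a : G | a ∈ H ∧ y * a ∈ autOrbit α y}) (fun a ha => ha.1)
      ?_ ((h.of_mem hy).card_lt_two_mul_fiber hH)
    rintro a ⟨ha, hya⟩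
    rw [autOrbit_eq_of_mem hy] at hya
    have h1 := hk _ hya
    rw [map_mul, hk y hy, mul_inv_rev] at h1
    have h2 : y * a * y⁻¹ = ((α ^ k) a)⁻¹ := by
      rw [inv_mul_eq_iff_eq_mul] at h1
      rw [h1]; group
    change y * a * y⁻¹ ∈ H
    rw [h2]
    exact H.inv_mem (hH.zpow_mem k ha)
  exact hle ha

theorem HasLargeOrbit.inv_mem_orbit (h : HasLargeOrbit α x) {y : G} (hy : y ∈ autOrbit α x) :
    y⁻¹ ∈ autOrbit α x := by
  obtain ⟨k, hk⟩ := h.exists_zpow_eq_inv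
  rw [← hk y hy]
  exact zpow_mem_autOrbit k hy

theorem HasLargeOrbit.normal (h : HasLargeOrbit α x) {H : Subgroup G} (hH : IsAutInvariant α H) :
    H.Normal := by
  refine ⟨fun a ha g => ?_⟩
  obtain ⟨y, hy, z, hz, rfl⟩ := h.exists_mul_inv_eq g
  have h1 := h.conj_mem hH hy (h.conj_mem hH (h.inv_mem_orbit hz) ha)
  simpa [mul_assoc] using h1

/-- Commutativity of `H` makes `a ↦ ((α ^ k) a)⁻¹` a homomorphism on `H`, so agreement with
conjugation on more than half of `H` suffices. -/
theorem HasLargeOrbit.conj_eq_inv_of_commute (h : HasLargeOrbit α x) {H : Subgroup G}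
    (hH : IsAutInvariant α H) (hcomm : ∀ a ∈ H, ∀ b ∈ H, a * b = b * a) {k : ℤ}
    (hk : ∀ y ∈ autOrbit α x, (α ^ k) y = y⁻¹) {y : G} (hy : y ∈ autOrbit α x) {a : G}
    (ha : a ∈ H) : y * a * y⁻¹ = ((α ^ k) a)⁻¹ := by
  let K : Subgroup G :=
    { carrier := {a | a ∈ H ∧ y * a * y⁻¹ = ((α ^ k) a)⁻¹}
      one_mem' := ⟨H.one_mem, by simp⟩
      mul_mem' := by
        rintro a b ⟨ha, ha'⟩ ⟨hb, hb'⟩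
        refine ⟨H.mul_mem ha hb, ?_⟩
        rw [show (α ^ k) (a * b) = (α ^ k) b * (α ^ k) a by rw [hcomm a ha b hb, map_mul],
          mul_inv_rev, ← ha', ← hb']
        group
      inv_mem' := by
        rintro a ⟨ha, ha'⟩
        refine ⟨H.inv_mem ha, ?_⟩
        rw [map_inv, ← ha']
        group }
  have hle : H ≤ K := by
    refine le_of_card_lt_two_mul (s := {a : G | a ∈ H ∧ y * a ∈ autOrbit α y}) (fun a ha => ha.1)
      ?_ ((h.of_mem hy).card_lt_two_mul_fiber hH)
    rintro a ⟨ha, hya⟩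
    rw [autOrbit_eq_of_mem hy] at hya
    have h1 := hk _ hya
    rw [map_mul, hk y hy, mul_inv_rev, inv_mul_eq_iff_eq_mul] at h1
    refine ⟨ha, ?_⟩
    rw [h1]; group
  exact (hle ha).2

theorem HasLargeOrbit.le_center (h : HasLargeOrbit α x) {H : Subgroup G}
    (hH : IsAutInvariant α H) (hcomm : ∀ a ∈ H, ∀ b ∈ H, a * b = b * a) :
    H ≤ Subgroup.center G := by
  obtain ⟨k, hk⟩ := h.exists_zpow_eq_inv
  intro a ha
  rw [Subgroup.mem_center_iff]
  intro g
  obtain ⟨y, hy, z, hz, rfl⟩ := h.exists_mul_inv_eq g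
  have h1 := h.conj_mem hH (h.inv_mem_orbit hz) ha
  have h2 := h.conj_eq_inv_of_commute hH hcomm hk hy h1
  have h3 := h.conj_eq_inv_of_commute hH hcomm hk hz h1
  rw [← h3] at h2
  have h4 : y * z⁻¹ * a = (y * (z⁻¹ * a * z⁻¹⁻¹) * y⁻¹) * (y * z⁻¹) := by group
  rw [h4, h2]
  group

theorem HasLargeOrbit.exists_quotient (h : HasLargeOrbit α x) {N : Subgroup G} [N.Normal]
    (hN : IsAutInvariant α N) : ∃ β : MulAut (G ⧸ N), (∀ g : G, β (g : G ⧸ N) = (α g : G)) ∧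
      HasLargeOrbit β (x : G ⧸ N) := by
  have hmap : N.map (α : G →* G) = N := by
    refine Subgroup.eq_of_le_of_card_ge ?_ ?_
    · rintro _ ⟨a, ha, rfl⟩
      exact hN a ha
    · rw [Subgroup.card_map_of_injective α.injective]
  refine ⟨QuotientGroup.congr N N α hmap, fun g => rfl, ?_⟩
  have h1 := card_range_lt_two_mul_orbit h (f := QuotientGroup.mk' N)
    (α' := QuotientGroup.congr N N α hmap) (fun g => rfl)
  rw [QuotientGroup.range_mk', Subgroup.card_top] at h1
  exact h1

theorem HasLargeOrbit.mul_comm_of_commutator_mem_center (h : HasLargeOrbit α x)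
    (hc : ∀ a b : G, a * b * a⁻¹ * b⁻¹ ∈ Subgroup.center G) (a b : G) : a * b = b * a := by
  obtain ⟨k, hk⟩ := h.exists_zpow_eq_inv
  obtain ⟨ι, hι⟩ : ∃ ι : MulAut G, ι = α ^ k := ⟨_, rfl⟩
  rw [← hι] at hk
  have hια : ∀ g, ι (α g) = α (ι g) := fun g => by rw [hι, aut_zpow_comm]
  have hcen : ∀ z ∈ Subgroup.center G, ∀ g, g * z = z * g :=
    fun z hz => Subgroup.mem_center_iff.1 hz
  have hιz : ∀ z ∈ Subgroup.center G, ι z = z⁻¹ := by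
    intro z hz
    have h1 := h.conj_eq_inv_of_commute (isAutInvariant_center α)
      (fun a _ b hb => hcen b hb a) (hι ▸ hk) (mem_autOrbit_self α x) hz
    rw [hcen z hz, mul_inv_cancel_right, ← hι] at h1
    exact (inv_eq_iff_eq_inv.2 h1).symm
  have hιg : ∀ g, ι g * g ∈ Subgroup.center G := by
    intro g
    obtain ⟨y, hy, z, hz, rfl⟩ := h.exists_mul_inv_eq g
    have h1 := hc y⁻¹ z
    rw [map_mul, map_inv, hk y hy, hk z hz]
    simpa [mul_assoc] using h1
  obtain ⟨c, hcdef⟩ : ∃ c : G → G → G, ∀ a b, c a b = a * b * a⁻¹ * b⁻¹ := ⟨_, fun _ _ => rfl⟩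
  have hc' : ∀ a b, c a b ∈ Subgroup.center G := fun a b => hcdef a b ▸ hc a b
  have hswap : ∀ a b, a * b = c a b * (b * a) := fun a b => by rw [hcdef]; group
  have hcl : ∀ a a' b, c (a * a') b = c a b * c a' b := by
    intro a a' b
    calc c (a * a') b = a * c a' b * (b * a⁻¹ * b⁻¹) := by rw [hcdef, hcdef]; group
      _ = c a' b * c a b := by rw [hcen _ (hc' a' b), hcdef a b]; group
      _ = _ := hcen _ (hc' a b) _
  have hcr : ∀ a b b', c a (b * b') = c a b * c a b' := by
    intro a b b'
    calc c a (b * b') = a * b * a⁻¹ * c a b' * b⁻¹ := by rw [hcdef, hcdef]; group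
      _ = c a b' * c a b := by rw [hcen _ (hc' a b'), hcdef a b]; group
      _ = _ := hcen _ (hc' a b) _
  have hczl : ∀ z ∈ Subgroup.center G, ∀ g, c z g = 1 := fun z hz g => by
    rw [hcdef, ← hcen z hz g]; group
  have hczr : ∀ z ∈ Subgroup.center G, ∀ g, c g z = 1 := fun z hz g => by
    rw [hcdef, hcen z hz g]; group
  have hcιr : ∀ a b, c a (ι b) = (c a b)⁻¹ := fun a b =>
    eq_inv_of_mul_eq_one_left (by rw [← hcr, hczr _ (hιg b)])
  have hcιl : ∀ a b, c (ι a) b = (c a b)⁻¹ := fun a b =>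
    eq_inv_of_mul_eq_one_left (by rw [← hcl, hczl _ (hιg a)])
  have hcinv : ∀ a b, c a⁻¹ b = (c a b)⁻¹ := fun a b =>
    eq_inv_of_mul_eq_one_left (by
      rw [← hcl, inv_mul_cancel, hczl _ (Subgroup.one_mem _)])
  -- `ι` inverts the central element `c a b`, yet fixes it because it inverts both arguments modulo
  -- the center.
  have hcsq : ∀ a b, c a b * c a b = 1 := by
    intro a b
    have h1 : ι (c a b) = c (ι a) (ι b) := by simp only [hcdef, map_mul, map_inv]
    rw [hιz _ (hc' a b), hcιl, hcιr, inv_inv] at h1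
    exact inv_eq_iff_mul_eq_one.1 h1
  have hsq : ∀ g, g * g ∈ Subgroup.center G := by
    intro g
    rw [Subgroup.mem_center_iff]
    intro a
    have h1 := hcl g g a
    rw [hcsq, hcdef] at h1
    exact (mul_inv_eq_one.1 (by rw [← h1]; group)).symm
  have hcG : ∀ u v : G ⧸ Subgroup.center G, u * v = v * u := by
    intro u v
    obtain ⟨u, rfl⟩ := QuotientGroup.mk_surjective u
    obtain ⟨v, rfl⟩ := QuotientGroup.mk_surjective v
    rw [← QuotientGroup.mk_mul, ← QuotientGroup.mk_mul, hswap u v, QuotientGroup.mk_mul,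
      (QuotientGroup.eq_one_iff _).2 (hc' u v), one_mul]
  let _ : CommGroup (Subgroup.center G) := { (inferInstance : Group (Subgroup.center G)) with
    mul_comm := fun u v => Subtype.ext (hcen v v.2 u) }
  let _ : CommGroup (G ⧸ Subgroup.center G) := { (inferInstance : Group (G ⧸ Subgroup.center G)) with
    mul_comm := hcG }
  have hout : ∀ g : G, ∃ z ∈ Subgroup.center G, ((g : G ⧸ Subgroup.center G)).out = g * z := by
    intro g
    obtain ⟨z, hz⟩ := QuotientGroup.mk_out_eq_mul (Subgroup.center G) g
    exact ⟨z, z.2, hz⟩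
  -- `ι g * g` depends only on the coset of `g`, since `ι` inverts the center.
  obtain ⟨q, hq⟩ : ∃ q : G ⧸ Subgroup.center G → Subgroup.center G,
      ∀ g : G, (q g : G) = ι g * g := by
    refine ⟨fun v => ⟨ι v.out * v.out, hιg _⟩, fun g => ?_⟩
    obtain ⟨z, hz, hgz⟩ := hout g
    simp only [hgz]
    rw [map_mul, hιz z hz, hcen z hz g, mul_assoc, inv_mul_cancel_left]
  obtain ⟨B, hB⟩ : ∃ B : G ⧸ Subgroup.center G → G ⧸ Subgroup.center G → Subgroup.center G,
      ∀ g g' : G, (B g g' : G) = c g g' := by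
    refine ⟨fun u v => ⟨c u.out v.out, hc' _ _⟩, fun g g' => ?_⟩
    obtain ⟨z, hz, hgz⟩ := hout g
    obtain ⟨z', hz', hgz'⟩ := hout g'
    simp only [hgz, hgz']
    rw [hcl, hcr, hczl z hz, hczr z' hz', mul_one, mul_one]
  obtain ⟨β, hβ, hlarge⟩ := h.exists_quotient (isAutInvariant_center α)
  have hsub : Subsingleton (G ⧸ Subgroup.center G) := by
    refine hlarge.subsingleton_of_quadratic (q := q) (b := B) ?_ ?_ ?_ ?_ ?_ ?_
    · intro v
      obtain ⟨v, rfl⟩ := QuotientGroup.mk_surjective v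
      exact (QuotientGroup.eq_one_iff _).2 (hsq v)
    · intro u v
      obtain ⟨u, rfl⟩ := QuotientGroup.mk_surjective u
      obtain ⟨v, rfl⟩ := QuotientGroup.mk_surjective v
      apply Subtype.ext
      rw [← QuotientGroup.mk_mul, Subgroup.coe_mul, Subgroup.coe_mul, hq, hq, hq, hB]
      have h1 : u⁻¹ * ι v = c u v * (ι v * u⁻¹) := by
        rw [hswap u⁻¹ (ι v), hcinv, hcιr, inv_inv]
      calc ι (u * v) * (u * v) = ι u * u * (u⁻¹ * ι v) * u * v := by rw [map_mul]; group
        _ = ι u * u * c u v * ι v * v := by rw [h1]; group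
        _ = c u v * (ι u * u) * ι v * v := by rw [hcen _ (hc' u v)]
        _ = _ := by rw [hcen _ (hc' u v)]; group
    · intro u v w
      obtain ⟨u, rfl⟩ := QuotientGroup.mk_surjective u
      obtain ⟨v, rfl⟩ := QuotientGroup.mk_surjective v
      obtain ⟨w, rfl⟩ := QuotientGroup.mk_surjective w
      apply Subtype.ext
      rw [← QuotientGroup.mk_mul, Subgroup.coe_mul, hB, hB, hB, hcr]
    · intro v
      obtain ⟨v, rfl⟩ := QuotientGroup.mk_surjective v
      rw [hβ, ← Subtype.coe_inj, ← Subtype.coe_inj, hq, hq, hια, ← map_mul, Subgroup.coe_one,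
        map_eq_one_iff α α.injective]
    · apply Subtype.ext
      rw [hq, hk x (mem_autOrbit_self α x), inv_mul_cancel, Subgroup.coe_one]
    · intro I hI hBI
      have hle : I.comap (QuotientGroup.mk' (Subgroup.center G)) ≤ Subgroup.center G := by
        refine h.le_center (fun g hg => ?_) fun g hg g' hg' => ?_
        · have h1 := hI _ hg
          rw [QuotientGroup.mk'_apply, hβ] at h1
          exact h1
        · have h1 := hBI _ hg _ hg'
          rw [← Subtype.coe_inj, QuotientGroup.mk'_apply, QuotientGroup.mk'_apply, hB] at h1
          rw [hswap, h1, Subgroup.coe_one, one_mul]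
      rw [Subgroup.eq_bot_iff_forall]
      intro v hv
      obtain ⟨v, rfl⟩ := QuotientGroup.mk_surjective v
      exact (QuotientGroup.eq_one_iff _).2 (hle hv)
  have ha : a ∈ Subgroup.center G :=
    (QuotientGroup.eq_one_iff a).1 (Subsingleton.elim _ _)
  exact (hcen a ha b).symm

/-- A finite group with an automorphism that has an orbit containing more than half of the
elements is commutative. -/
theorem HasLargeOrbit.mul_comm {G : Type*} [Group G] [Finite G] {α : MulAut G} {x : G}
    (h : HasLargeOrbit α x) (a b : G) : a * b = b * a := by
  obtain ⟨n, hn⟩ : ∃ n, n = Nat.card G := ⟨_, rfl⟩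
  induction n using Nat.strong_induction_on generalizing G with
  | _ n ih =>
  have hquot : ∀ N : Subgroup G, IsAutInvariant α N → N ≠ ⊥ → ∀ g k : G, g * k * g⁻¹ * k⁻¹ ∈ N := by
    intro N hN hne g k
    have := h.normal hN
    obtain ⟨β, hβ, hlarge⟩ := h.exists_quotient hN
    have hlt : Nat.card (G ⧸ N) < n := by
      have h1 := Subgroup.card_eq_card_quotient_mul_card_subgroup N
      have h2 := (Subgroup.one_lt_card_iff_ne_bot N).2 hne
      have h3 : 0 < Nat.card (G ⧸ N) := Nat.card_pos
      rw [hn, h1]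
      exact lt_mul_of_one_lt_right h3 h2
    have h4 := ih _ hlt hlarge g k rfl
    rw [← QuotientGroup.eq_one_iff]
    change (g : G ⧸ N) * k * (g : G ⧸ N)⁻¹ * (k : G ⧸ N)⁻¹ = 1
    rw [h4]
    group
  by_cases hZ : Subgroup.center G = ⊥
  swap
  · exact h.mul_comm_of_commutator_mem_center (hquot _ (isAutInvariant_center α) hZ) a b
  by_cases hall : ∀ g, g ≠ 1 → g ∈ autOrbit α x
  · obtain ⟨k, hk⟩ := h.exists_zpow_eq_inv
    have hinv : ∀ g, (α ^ k) g = g⁻¹ := fun g => by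
      by_cases hg : g = 1
      · simp [hg]
      · exact hk g (hall g hg)
    have h1 := map_mul (α ^ k) a⁻¹ b⁻¹
    simp only [hinv, mul_inv_rev, inv_inv] at h1
    exact h1.symm
  push Not at hall
  obtain ⟨g, hg1, hg⟩ := hall
  -- Otherwise the stabilizer of `g` in the powers of `α` would fix `x`, so the orbit of `g` would
  -- be at least as long as that of `x` and would meet it.
  obtain ⟨l, hl, hlx⟩ : ∃ l : ℤ, (α ^ l) g = g ∧ (α ^ l) x ≠ x := by
    by_contra! hcon
    have hle : (autOrbit α x).ncard ≤ (autOrbit α g).ncard := by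
      choose! f hf using fun (y : G) (hy : y ∈ autOrbit α x) => hy
      refine Set.ncard_le_ncard_of_injOn
        (fun y => (α ^ f y) g) (fun y _ => ⟨f y, rfl⟩) ?_ (Set.toFinite _)
      intro y hy z hz hyz
      have h1 : (α ^ (-f z + f y)) g = g := by
        rw [zpow_add_aut_apply, show (α ^ f y) g = (α ^ f z) g from hyz, ← zpow_add_aut_apply, neg_add_cancel]; simp
      have h2 := hcon _ h1
      have h3 := congrArg (α ^ f z) h2
      rw [← zpow_add_aut_apply, add_neg_cancel_left, hf y hy, hf z hz] at h3
      exact h3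
    obtain ⟨y, hy, hy'⟩ := inter_nonempty_of_card_lt (s := autOrbit α x) (t := autOrbit α g)
      (by unfold HasLargeOrbit at h; omega)
    apply hg
    rw [← autOrbit_eq_of_mem hy, autOrbit_eq_of_mem hy']
    exact mem_autOrbit_self α g
  let F : Subgroup G := MonoidHom.eqLocus (α ^ l).toMonoidHom (MonoidHom.id G)
  have hF : ∀ f, f ∈ F ↔ (α ^ l) f = f := fun f => Iff.rfl
  have hFinv : IsAutInvariant α F := fun f hf => by
    rw [hF] at hf ⊢
    rw [← aut_zpow_comm, hf]
  have hFne : F ≠ ⊥ := fun hb => hg1 (Subgroup.mem_bot.1 (hb ▸ (hF g).2 hl))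
  have hFn := h.normal hFinv
  let C : Subgroup G := Subgroup.centralizer F
  have hC : ∀ c, c ∈ C ↔ ∀ f ∈ F, f * c = c * f := fun c => Subgroup.mem_centralizer_iff
  have hCinv : IsAutInvariant α C := by
    intro c hc
    rw [hC] at hc ⊢
    intro f hf
    have h1 := hc _ (hFinv.zpow_mem (-1) hf)
    have h2 := congrArg α h1
    have h3 : α ((α ^ (-1 : ℤ)) f) = f := by simp
    rwa [map_mul, map_mul, h3] at h2
  have hCF : C ⊓ F = ⊥ := by
    rw [← le_bot_iff, ← hZ]
    exact h.le_center (fun y hy => ⟨hCinv y hy.1, hFinv y hy.2⟩)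
      fun y hy z hz => (hC z).1 hz.1 y hy.2
  by_cases hCb : C = ⊥
  · exfalso
    apply hlx
    -- For `f ∈ F`, both `f` and its conjugate by `x` are fixed by `α ^ l`, so `x` and `(α ^ l) x`
    -- conjugate `f` alike.
    have h1 : x⁻¹ * (α ^ l) x ∈ C := by
      rw [hC]
      intro f hf
      have h2 : x * f * x⁻¹ ∈ F := hFn.conj_mem f hf x
      have hf' := (hF _).1 hf
      have h3 := (hF _).1 h2
      rw [map_mul, map_mul, map_inv, hf', mul_inv_eq_iff_eq_mul] at h3
      rw [mul_assoc, h3]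
      group
    rw [hCb, Subgroup.mem_bot, inv_mul_eq_one] at h1
    exact h1.symm
  · have h1 : a * b * a⁻¹ * b⁻¹ ∈ C ⊓ F := ⟨hquot C hCinv hCb a b, hquot F hFinv hFne a b⟩
    rw [hCF, Subgroup.mem_bot, mul_inv_eq_one, mul_inv_eq_iff_eq_mul] at h1
    exact h1

end Noncommutative

/-! ### Translation to cycle lengths, and sharpness for dihedral groups -/

theorem cycleLength_toEquiv {G : Type*} [Group G] (α : MulAut G) (x : G) :
    cycleLength α.toEquiv x = (autOrbit α x).ncard := by
  have hpow : ∀ (k : ℤ) (y : G), ((α.toEquiv : Equiv.Perm G) ^ k) y = (α ^ k) y := by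
    intro k y
    have h := map_zpow (MulAut.toPerm G) α k
    exact (DFunLike.congr_fun h y).symm
  unfold cycleLength
  congr 1
  ext y
  constructor
  · rintro ⟨k, hk⟩
    exact ⟨k, by rw [← hpow, hk]⟩
  · rintro ⟨k, hk⟩
    exact ⟨k, by rw [hpow, hk]⟩

theorem hasLargeOrbit_of_half_lt_groupLambda {G : Type*} [Group G] [Finite G]
    (h : (1 / 2 : ℚ) < groupLambda G) : ∃ (α : MulAut G) (x : G), HasLargeOrbit α x := by
  obtain ⟨α, hα⟩ := exists_eq_ciSup_of_finite (f := fun α : MulAut G => permLambdaAbs α.toEquiv)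
  obtain ⟨x, hx⟩ := exists_eq_ciSup_of_finite (f := fun x : G => cycleLength α.toEquiv x)
  refine ⟨α, x, ?_⟩
  have h1 : groupLambdaAbs G = (autOrbit α x).ncard := by
    rw [← cycleLength_toEquiv, hx]
    exact hα.symm
  have hpos : (0 : ℚ) < Nat.card G := by exact_mod_cast Nat.card_pos
  rw [groupLambda, h1, lt_div_iff₀ hpos] at h
  have h2 : (Nat.card G : ℚ) < 2 * (autOrbit α x).ncard := by linarith
  exact_mod_cast h2

theorem ncard_autOrbit_le_groupLambdaAbs {G : Type*} [Group G] [Finite G] (α : MulAut G) (x : G) :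
    (autOrbit α x).ncard ≤ groupLambdaAbs G := by
  rw [← cycleLength_toEquiv]
  exact (le_ciSup (Set.finite_range fun x : G => cycleLength α.toEquiv x).bddAbove x).trans
    (le_ciSup (Set.finite_range fun α : MulAut G => permLambdaAbs α.toEquiv).bddAbove α)

namespace DihedralGroup

/-- The automorphism of the dihedral group that fixes all rotations and shifts the reflections. -/
def shiftAut (n : ℕ) : MulAut (DihedralGroup n) where
  toFun
    | r i => r i
    | sr i => sr (i + 1)
  invFun
    | r i => r i
    | sr i => sr (i - 1)
  left_inv := by rintro (i | i) <;> simp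
  right_inv := by rintro (i | i) <;> simp
  map_mul' := by
    rintro (i | i) (j | j) <;> simp <;> ring

theorem shiftAut_pow_sr_zero (n k : ℕ) : (shiftAut n ^ k) (sr 0) = sr (k : ZMod n) := by
  induction k with
  | zero => simp
  | succ k ih =>
    rw [pow_succ', MulAut.mul_apply, ih]
    push_cast
    rfl

theorem le_ncard_autOrbit_shiftAut (n : ℕ) [NeZero n] :
    n ≤ (autOrbit (shiftAut n) (sr 0)).ncard := by
  have h1 : Set.range (sr : ZMod n → DihedralGroup n) ⊆ autOrbit (shiftAut n) (sr 0) := by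
    rintro _ ⟨i, rfl⟩
    exact ⟨(i.val : ℤ), by rw [zpow_natCast, shiftAut_pow_sr_zero, ZMod.natCast_zmod_val]⟩
  have h2 : (Set.range (sr : ZMod n → DihedralGroup n)).ncard = n := by
    rw [← Set.image_univ, Set.ncard_image_of_injective _ (fun i j hij => by simpa using hij),
      Set.ncard_univ, Nat.card_zmod]
  exact h2.symm.le.trans (Set.ncard_le_ncard h1 (Set.toFinite _))

theorem not_forall_mul_comm {n : ℕ} (hn : 3 ≤ n) :
    ¬ ∀ a b : DihedralGroup n, a * b = b * a := by
  intro h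
  have h1 := h (r 1) (sr 0)
  rw [r_mul_sr, sr_mul_r, sr.injEq] at h1
  have h2 : ((2 : ℕ) : ZMod n) = 0 := by
    push_cast
    linear_combination -h1
  rw [ZMod.natCast_eq_zero_iff] at h2
  exact absurd (Nat.le_of_dvd (by norm_num) h2) (by omega)

end DihedralGroup

theorem mainTheorem1 :
    (∀ (G : Type*) [Group G] [Finite G],
      (1 / 2 : ℚ) < groupLambda G → ∀ a b : G, a * b = b * a) ∧
    (∀ n : ℕ, 3 ≤ n →
      (¬ ∀ a b : DihedralGroup n, a * b = b * a) ∧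
        groupLambda (DihedralGroup n) = 1 / 2) := by
  refine ⟨fun G _ _ hG => ?_, fun n hn => ⟨DihedralGroup.not_forall_mul_comm hn, ?_⟩⟩
  · obtain ⟨α, x, h⟩ := hasLargeOrbit_of_half_lt_groupLambda hG
    exact h.mul_comm
  · have : NeZero n := ⟨by omega⟩
    -- The upper bound is the first half of the theorem applied to a noncommutative group; the lower
    -- bound comes from the `n` reflections forming one cycle.
    refine le_antisymm (not_lt.1 fun h => ?_) ?_
    · obtain ⟨α, x, h⟩ := hasLargeOrbit_of_half_lt_groupLambda h
      exact DihedralGroup.not_forall_mul_comm hn h.mul_comm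
    · have h1 : n ≤ groupLambdaAbs (DihedralGroup n) :=
        (DihedralGroup.le_ncard_autOrbit_shiftAut n).trans (ncard_autOrbit_le_groupLambdaAbs _ _)
      have hpos : (0 : ℚ) < n := by exact_mod_cast (by omega : 0 < n)
      rw [groupLambda, DihedralGroup.nat_card, le_div_iff₀ (by push_cast; positivity)]
      push_cast
      have h2 : (n : ℚ) ≤ groupLambdaAbs (DihedralGroup n) := by exact_mod_cast h1
      linarith
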